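/- Let $\mathbb F$ be an algebraically closed field of characteristic $p\neq 2$. Put $\mathbb I=\mathbb Z_{\ge 0}$ if $p=0$ and $\mathbb I=\{0,1,\ldots,\frac{p-1}{2}\}$ if $p\ge 3$, and $q(i)=i(i+1)\in\mathbb F$ for $i\in\mathbb I$. For $n\ge 0$ let $\mathfrak H_n^{\mathfrak c}$ be the affine Hecke-Clifford algebra: the $\mathbb F$-superalgebra with even generators $s_1,\ldots,s_{n-1},x_1,\ldots,x_n$, odd generators $c_1,\ldots,c_n$, and relations (for all admissible indices) $$s_i^2=1,\quad s_is_j=s_js_i\ (|i-j|>1),\quad s_is_{i+1}s_i=s_{i+1}s_is_{i+1},$$ $$x_ix_j=x_jx_i,\quad c_i^2=1,\quad c_ic_j=-c_jc_i\ (i\ne j),$$ $$s_ix_i=x_{i+1}s_i-(1+c_ic_{i+1}),\quad s_ix_j=x_js_i\ (j\neq i,i+1),$$ $$s_ic_i=c_{i+1}s_i,\quad s_ic_{i+1}=c_is_i,\quad s_ic_j=c_js_i\ (j\ne i,i+1),$$ $$x_ic_i=-c_ix_i,\quad x_ic_j=c_jx_i\ (i\ne j).$$ Modules are $\mathbb Z_2$-graded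 left modules, and irreducible means nonzero without proper nonzero graded submodules. Let $M$ be a finite-dimensional irreducible $\mathfrak H_n^{\mathfrak c}$-module which is integral (all eigenvalues of $x_1^2,\ldots,x_n^2$ on $M$ are of the form $q(i)$ with $i\in\mathbb I$) and completely splittable ($x_1,\ldots,x_n$ act semisimply on $M$). Let $\underline i=(i_1,\ldots,i_n)\in\mathbb I^n$ be a weight of $M$, that is, $$M_{\underline i}=\{z\in M \mid (x_k^2-q(i_k))^Nz=0\text{ for }N\gg0,\ 1\le k\le n\}\neq 0 .$$ Then: 1. $i_k\neq i_{k+1}$ for all $1\le k\le n-1$. 2. If $p\ge 3$, then $\frac{p-1}{2}$ appears at most once in $\underline i$. 3. If $i_k=i_l=0$ for some $1\le k<l\le n$, then $1\in\{i_{k+1},\ldots,i_{l-1}\}$. 4. If $p=0$ and $i_k=i_l\ge 1$ for some $1\le k<l\le n$, then $\{i_k-1,i_k+1\}\subseteq\{i_{k+1},\ldots,i_{l-1}\}$. 5. If $p\ge 3$ and $i_k=i_l\ge 1$ for some $1\le k<l\le n$, then at least one of the following holds: (a) $\{i_k-1,i_k+1\}\subseteq\{i_{k+1},\ldots,i_{l-1}\}$;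 (b) $i_k\le\frac{p-3}{2}$ and, with $d=\frac{p-3}{2}-i_k$, there are integers $k\le r_0<r_1<\cdots<r_d<q<t_d<\cdots<t_1<t_0\le l$ such that $i_q=\frac{p-1}{2}$ and, for each $0\le j\le d$, $i_{r_j}=i_{t_j}=i_k+j$ and $i_k+j$ does not appear between $i_{r_j}$ and $i_{t_j}$ in $\underline i$ (that is, $i_m\ne i_k+j$ for $r_j<m<t_j$). -/

import Mathlib

namespace HeckeClifford

/-- Generators of the affine Hecke-Clifford algebra on `n` strands. Indices start at `0`:
`s k` (with `k + 1 < n`) is the transposition exchanging the strands `k` and `k + 1`. -/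
inductive Gen (n : ℕ) : Type
  | s (k : ℕ) (h : k + 1 < n) : Gen n
  | x (k : Fin n) : Gen n
  | c (k : Fin n) : Gen n

/-- The parity of a generator: `s` and `x` are even, `c` is odd. -/
def Gen.parity {n : ℕ} : Gen n → ZMod 2
  | Gen.s _ _ => 0
  | Gen.x _ => 0
  | Gen.c _ => 1

section Algebra

variable (F : Type*) [Field F] (n : ℕ)

/-- The free generators, as elements of the free algebra. -/
def fs (k : ℕ) (h : k + 1 < n) : FreeAlgebra F (Gen n) := FreeAlgebra.ι F (Gen.s k h)

/-- The free generators, as elements of the free algebra. -/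
def fx (k : Fin n) : FreeAlgebra F (Gen n) := FreeAlgebra.ι F (Gen.x k)

/-- The free generators, as elements of the free algebra. -/
def fc (k : Fin n) : FreeAlgebra F (Gen n) := FreeAlgebra.ι F (Gen.c k)

/-- The defining relations of the affine Hecke-Clifford algebra. -/
inductive Rel : FreeAlgebra F (Gen n) → FreeAlgebra F (Gen n) → Prop
  | s_sq (k : ℕ) (h : k + 1 < n) : Rel (fs F n k h * fs F n k h) 1
  | s_comm (k l : ℕ) (hk : k + 1 < n) (hl : l + 1 < n) (hkl : k + 1 < l ∨ l + 1 < k) :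
      Rel (fs F n k hk * fs F n l hl) (fs F n l hl * fs F n k hk)
  | braid (k : ℕ) (h : k + 1 + 1 < n) :
      Rel (fs F n k (by omega) * fs F n (k + 1) h * fs F n k (by omega))
        (fs F n (k + 1) h * fs F n k (by omega) * fs F n (k + 1) h)
  | x_comm (i j : Fin n) : Rel (fx F n i * fx F n j) (fx F n j * fx F n i)
  | c_sq (i : Fin n) : Rel (fc F n i * fc F n i) 1
  | c_anticomm (i j : Fin n) (hij : i ≠ j) :
      Rel (fc F n i * fc F n j) (-(fc F n j * fc F n i))
  | s_x (k : ℕ) (h : k + 1 < n) :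
      Rel (fs F n k h * fx F n ⟨k, by omega⟩)
        (fx F n ⟨k + 1, h⟩ * fs F n k h - (1 + fc F n ⟨k, by omega⟩ * fc F n ⟨k + 1, h⟩))
  | s_x_comm (k : ℕ) (h : k + 1 < n) (j : Fin n) (hj : j.val ≠ k) (hj' : j.val ≠ k + 1) :
      Rel (fs F n k h * fx F n j) (fx F n j * fs F n k h)
  | s_c (k : ℕ) (h : k + 1 < n) :
      Rel (fs F n k h * fc F n ⟨k, by omega⟩) (fc F n ⟨k + 1, h⟩ * fs F n k h)
  | s_c_succ (k : ℕ) (h : k + 1 < n) :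
      Rel (fs F n k h * fc F n ⟨k + 1, h⟩) (fc F n ⟨k, by omega⟩ * fs F n k h)
  | s_c_comm (k : ℕ) (h : k + 1 < n) (j : Fin n) (hj : j.val ≠ k) (hj' : j.val ≠ k + 1) :
      Rel (fs F n k h * fc F n j) (fc F n j * fs F n k h)
  | x_c (i : Fin n) : Rel (fx F n i * fc F n i) (-(fc F n i * fx F n i))
  | x_c_comm (i j : Fin n) (hij : i ≠ j) : Rel (fx F n i * fc F n j) (fc F n j * fx F n i)

/-- The affine Hecke-Clifford algebra, by generators and relations over `F`. -/
def AffineHeckeClifford : Type _ := RingQuot (Rel F n)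

noncomputable instance : Ring (AffineHeckeClifford F n) :=
  inferInstanceAs (Ring (RingQuot (Rel F n)))

noncomputable instance : Algebra F (AffineHeckeClifford F n) :=
  inferInstanceAs (Algebra F (RingQuot (Rel F n)))

/-- The image of a generator in the affine Hecke-Clifford algebra. -/
noncomputable def gen (g : Gen n) : AffineHeckeClifford F n :=
  RingQuot.mkAlgHom F (Rel F n) (FreeAlgebra.ι F g)

/-- The `ℤ/2`-grading of the affine Hecke-Clifford algebra: the component of parity `j` is
spanned by the words in the generators whose total parity is `j`. -/
noncomputable def component (j : ZMod 2) : Submodule F (AffineHeckeClifford F n) :=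
  Submodule.span F
    {a | ∃ w : List (Gen n), (w.map Gen.parity).sum = j ∧ a = (w.map (gen F n)).prod}

end Algebra

section Modules

variable {F : Type*} [Field F] {n : ℕ} {M : Type*} [AddCommGroup M] [Module F M]
  [Module (AffineHeckeClifford F n) M]

/-- `𝓜` is a `ℤ/2`-grading which makes `M` a (`ℤ/2`-graded, left) module over the superalgebra
`AffineHeckeClifford F n`. -/
structure IsSupermodule (𝓜 : ZMod 2 → Submodule F M) : Prop where
  isInternal : DirectSum.IsInternal 𝓜
  smul_mem : ∀ (i j : ZMod 2) (a : AffineHeckeClifford F n) (v : M),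
    a ∈ component F n i → v ∈ 𝓜 j → a • v ∈ 𝓜 (i + j)

/-- A submodule is graded if it is the sum of its intersections with the components of `M`. -/
def IsGradedSubmodule (𝓜 : ZMod 2 → Submodule F M)
    (N : Submodule (AffineHeckeClifford F n) M) : Prop :=
  ∀ v ∈ N, ∃ v₀ ∈ N, ∃ v₁ ∈ N, v₀ ∈ 𝓜 0 ∧ v₁ ∈ 𝓜 1 ∧ v = v₀ + v₁

/-- Irreducibility in the category of supermodules: `M ≠ 0`, and the only graded submodules
are `0` and `M`. -/
structure IsIrreducibleSupermodule (𝓜 : ZMod 2 → Submodule F M) : Prop where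
  isSupermodule : IsSupermodule (n := n) 𝓜
  nontrivial : Nontrivial M
  eq_bot_or_eq_top : ∀ N : Submodule (AffineHeckeClifford F n) M,
    IsGradedSubmodule 𝓜 N → N = ⊥ ∨ N = ⊤

/-- The index set: all natural numbers in characteristic `0`, and `{0, 1, …, (p - 1) / 2}` in
odd characteristic `p`. -/
def indexSet (p : ℕ) : Set ℕ := {i | p = 0 ∨ i ≤ (p - 1) / 2}

variable (F) in
/-- The scalar `q(i) = i (i + 1)` of `F`. -/
def q (i : ℕ) : F := (i : F) * ((i : F) + 1)

variable [IsScalarTower F (AffineHeckeClifford F n) M]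

variable (F M) in
/-- The operator on `M` by which the polynomial generator `x k` acts. -/
noncomputable def xOp (k : Fin n) : Module.End F M :=
  Algebra.lsmul F F M (gen F n (Gen.x k))

variable (F n M) in
/-- `M` is integral: all eigenvalues of the squares of the polynomial generators are of the form
`q i` with `i` in the index set. -/
def IsIntegralModule (p : ℕ) : Prop :=
  ∀ (k : Fin n) (a : F), (xOp F M k ^ 2).HasEigenvalue a → ∃ i ∈ indexSet p, a = q F i

variable (F n M) in
/-- `M` is completely splittable: the polynomial generators act semisimply. -/
def IsCompletelySplittable : Prop := ∀ k : Fin n, (xOp F M k).IsSemisimple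

variable (F M) in
/-- The weight space of `M`: the simultaneous generalized eigenspace of the squares of the
polynomial generators for the eigenvalues `q (i k)`. -/
noncomputable def weightSpace (i : Fin n → ℕ) : Submodule F M :=
  ⨅ k : Fin n, (xOp F M k ^ 2).maxGenEigenspace (q F (i k))

variable (F M) in
/-- `i` is a weight of `M`. -/
def IsWeight (p : ℕ) (i : Fin n → ℕ) : Prop :=
  (∀ k, i k ∈ indexSet p) ∧ weightSpace F M i ≠ ⊥

end Modules

end HeckeClifford

/-! Semisimplicity makes a weight space a common eigenspace of the operators x_k², and the weights
are controlled by the action of s_k on it. Write a, b for the eigenvalues of x_k², x_{k+1}². On a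
weight vector, (a - b) s_k + `twist` is an intertwiner into the weight space with entries k and k+1
exchanged. Semisimplicity rules out a = b (`q_ne_of_sqEigenspace_ne_bot`). If the exchanged space
vanishes, s_k acts as a multiple of `twist`, and s_k² = 1 forces (a - b)² = 2(a + b), that is,
adjacent entries differing by one (`sqEigenspace_swap_ne_bot`, `q_sub_sq_ne`). If i_k = i_{k+2},
neither exchange is possible, so s_k and s_{k+1} both act through `twist`; the braid relation then
leaves only i_k = 0 or the middle entry (p - 1)/2 (`q_eq_zero_or_of_triple`).

The rest is combinatorics of words with these three properties (`IsSplittableWeightSet`). A segment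
between equal entries is shortened by swaps until both its inner neighbours differ from the ends by
one; induction on length then gives `exists_succ` and `exists_nested_chain`. -/

namespace HeckeClifford

/-! ### Defining relations as identities on module elements. -/

section Relations

variable (F : Type*) [Field F] {n : ℕ}

/-- The generator `s k` of the affine Hecke-Clifford algebra. -/
noncomputable abbrev sGen (k : ℕ) (h : k + 1 < n) : AffineHeckeClifford F n := gen F n (Gen.s k h)

/-- The generator `x k` of the affine Hecke-Clifford algebra. -/
noncomputable abbrev xGen (k : Fin n) : AffineHeckeClifford F n := gen F n (Gen.x k)

/-- The generator `c k` of the affine Hecke-Clifford algebra. -/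
noncomputable abbrev cGen (k : Fin n) : AffineHeckeClifford F n := gen F n (Gen.c k)

/-- The projection of the free algebra onto the affine Hecke-Clifford algebra. -/
noncomputable def proj : FreeAlgebra F (Gen n) →ₐ[F] AffineHeckeClifford F n :=
  RingQuot.mkAlgHom F (Rel F n)

variable {F}

theorem proj_rel {a b : FreeAlgebra F (Gen n)} (h : Rel F n a b) : proj F a = proj F b :=
  RingQuot.mkAlgHom_rel F h

theorem proj_fs (k : ℕ) (h : k + 1 < n) : proj F (fs F n k h) = sGen F k h := rfl

theorem proj_fx (k : Fin n) : proj F (fx F n k) = xGen F k := rfl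

theorem proj_fc (k : Fin n) : proj F (fc F n k) = cGen F k := rfl

variable {M : Type*} [AddCommGroup M] [Module (AffineHeckeClifford F n) M]

theorem s_smul_s (k : ℕ) (h : k + 1 < n) (v : M) : sGen F k h • sGen F k h • v = v := by
  have := congrArg (· • v) (proj_rel (Rel.s_sq (F := F) k h))
  simpa [proj_fs, mul_smul] using this

theorem braid_smul (k : ℕ) (h : k + 1 + 1 < n) (v : M) :
    sGen F k (Nat.lt_of_succ_lt h) • sGen F (k + 1) h • sGen F k (Nat.lt_of_succ_lt h) • v =
      sGen F (k + 1) h • sGen F k (Nat.lt_of_succ_lt h) • sGen F (k + 1) h • v := by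
  have := congrArg (· • v) (proj_rel (Rel.braid (F := F) k h))
  simpa [proj_fs, mul_smul] using this

theorem x_smul_x (i j : Fin n) (v : M) : xGen F i • xGen F j • v = xGen F j • xGen F i • v := by
  have := congrArg (· • v) (proj_rel (Rel.x_comm (F := F) i j))
  simpa [proj_fx, mul_smul] using this

theorem c_smul_c_self (i : Fin n) (v : M) : cGen F i • cGen F i • v = v := by
  have := congrArg (· • v) (proj_rel (Rel.c_sq (F := F) i))
  simpa [proj_fc, mul_smul] using this

theorem c_smul_c {i j : Fin n} (hij : i ≠ j) (v : M) :
    cGen F i • cGen F j • v = -(cGen F j • cGen F i • v) := by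
  have := congrArg (· • v) (proj_rel (Rel.c_anticomm (F := F) i j hij))
  simpa [proj_fc, mul_smul] using this

theorem s_smul_x (k : ℕ) (h : k + 1 < n) (v : M) :
    sGen F k h • xGen F ⟨k, Nat.lt_of_succ_lt h⟩ • v = xGen F ⟨k + 1, h⟩ • sGen F k h • v -
      (v + cGen F ⟨k, Nat.lt_of_succ_lt h⟩ • cGen F ⟨k + 1, h⟩ • v) := by
  have := congrArg (· • v) (proj_rel (Rel.s_x (F := F) k h))
  simpa [proj_fs, proj_fx, proj_fc, mul_smul, sub_smul, add_smul] using this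

theorem s_smul_x_of_ne (k : ℕ) (h : k + 1 < n) {j : Fin n} (hj : j.val ≠ k) (hj' : j.val ≠ k + 1)
    (v : M) : sGen F k h • xGen F j • v = xGen F j • sGen F k h • v := by
  have := congrArg (· • v) (proj_rel (Rel.s_x_comm (F := F) k h j hj hj'))
  simpa [proj_fs, proj_fx, mul_smul] using this

theorem s_smul_c (k : ℕ) (h : k + 1 < n) (v : M) :
    sGen F k h • cGen F ⟨k, Nat.lt_of_succ_lt h⟩ • v = cGen F ⟨k + 1, h⟩ • sGen F k h • v := by
  have := congrArg (· • v) (proj_rel (Rel.s_c (F := F) k h))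
  simpa [proj_fs, proj_fc, mul_smul] using this

theorem s_smul_c_succ (k : ℕ) (h : k + 1 < n) (v : M) :
    sGen F k h • cGen F ⟨k + 1, h⟩ • v = cGen F ⟨k, Nat.lt_of_succ_lt h⟩ • sGen F k h • v := by
  have := congrArg (· • v) (proj_rel (Rel.s_c_succ (F := F) k h))
  simpa [proj_fs, proj_fc, mul_smul] using this

theorem x_smul_c_self (i : Fin n) (v : M) :
    xGen F i • cGen F i • v = -(cGen F i • xGen F i • v) := by
  have := congrArg (· • v) (proj_rel (Rel.x_c (F := F) i))
  simpa [proj_fx, proj_fc, mul_smul] using this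

theorem x_smul_c {i j : Fin n} (hij : i ≠ j) (v : M) :
    xGen F i • cGen F j • v = cGen F j • xGen F i • v := by
  have := congrArg (· • v) (proj_rel (Rel.x_c_comm (F := F) i j hij))
  simpa [proj_fx, proj_fc, mul_smul] using this

theorem x_succ_smul_s (k : ℕ) (h : k + 1 < n) (v : M) :
    xGen F ⟨k + 1, h⟩ • sGen F k h • v = sGen F k h • xGen F ⟨k, Nat.lt_of_succ_lt h⟩ • v +
      (v + cGen F ⟨k, Nat.lt_of_succ_lt h⟩ • cGen F ⟨k + 1, h⟩ • v) := by
  rw [s_smul_x]; abel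

/-- The relation for s_k x_k conjugated by s_k, which turns c_k c_{k+1} into c_{k+1} c_k = -c_k
c_{k+1}; hence the changed sign. -/
theorem x_smul_s (k : ℕ) (h : k + 1 < n) (v : M) :
    xGen F ⟨k, Nat.lt_of_succ_lt h⟩ • sGen F k h • v = sGen F k h • xGen F ⟨k + 1, h⟩ • v -
      (v - cGen F ⟨k, Nat.lt_of_succ_lt h⟩ • cGen F ⟨k + 1, h⟩ • v) := by
  have h1 := congrArg (sGen F k h • ·) (s_smul_x (F := F) k h (sGen F k h • v))
  simp only [s_smul_s, smul_sub, smul_add, s_smul_c, s_smul_c_succ] at h1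
  have hne : (⟨k, Nat.lt_of_succ_lt h⟩ : Fin n) ≠ ⟨k + 1, h⟩ := by simp
  rw [h1, c_smul_c hne]
  abel

end Relations

/-! ### Intertwiners between common eigenspaces. -/

section Twist

variable {F : Type*} [Field F] {n : ℕ} {M : Type*} [AddCommGroup M]
  [Module (AffineHeckeClifford F n) M]

variable (F) in
/-- The action of `x j + x l + c j * c l * (x j - x l)`, the part of the intertwining element of
the strands `j` and `l` that comes from the subalgebra generated by the `x`s and the `c`s. -/
noncomputable def twist (j l : Fin n) (v : M) : M :=
  xGen F j • v + xGen F l • v + cGen F j • cGen F l • (xGen F j • v - xGen F l • v)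

theorem x_sq_smul_s (k : ℕ) (h : k + 1 < n) (v : M) :
    xGen F ⟨k, Nat.lt_of_succ_lt h⟩ • xGen F ⟨k, Nat.lt_of_succ_lt h⟩ • sGen F k h • v =
      sGen F k h • xGen F ⟨k + 1, h⟩ • xGen F ⟨k + 1, h⟩ • v -
        twist F ⟨k, Nat.lt_of_succ_lt h⟩ ⟨k + 1, h⟩ v := by
  have hne : (⟨k, Nat.lt_of_succ_lt h⟩ : Fin n) ≠ ⟨k + 1, h⟩ := by simp
  simp only [x_smul_s, twist, smul_sub, x_smul_c_self, x_smul_c hne]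
  abel

theorem x_succ_sq_smul_s (k : ℕ) (h : k + 1 < n) (v : M) :
    xGen F ⟨k + 1, h⟩ • xGen F ⟨k + 1, h⟩ • sGen F k h • v =
      sGen F k h • xGen F ⟨k, Nat.lt_of_succ_lt h⟩ • xGen F ⟨k, Nat.lt_of_succ_lt h⟩ • v +
        twist F ⟨k, Nat.lt_of_succ_lt h⟩ ⟨k + 1, h⟩ v := by
  have hne : (⟨k, Nat.lt_of_succ_lt h⟩ : Fin n) ≠ ⟨k + 1, h⟩ := by simp
  simp only [x_succ_smul_s, twist, smul_sub, smul_add, x_smul_c_self, x_smul_c hne.symm, smul_neg]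
  abel

variable [Module F M]

/-- With c = c_j c_l, A = x_j + x_l and B = x_j - x_l, the operator is A + cB. Since c² = -1 and c
anticommutes with A and B, its square is A² + B². -/
theorem twist_twist {j l : Fin n} (h : j ≠ l) (v : M) : twist F j l (twist F j l v) =
    (2 : F) • (xGen F j • xGen F j • v + xGen F l • xGen F l • v) := by
  simp only [twist, smul_add, smul_sub, x_smul_c_self, x_smul_c h, x_smul_c h.symm, smul_neg,
    c_smul_c_self, c_smul_c h.symm, x_smul_x l j, neg_neg, two_smul]
  abel

variable [IsScalarTower F (AffineHeckeClifford F n) M]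

/-- The action of the algebra as a linear map. -/
theorem smul_eq_lsmul (a : AffineHeckeClifford F n) (v : M) : a • v = Algebra.lsmul F F M a v := rfl

variable (M) in
/-- The vectors on which `x k ^ 2` acts by `q (i k)` for all `k`. -/
noncomputable def sqEigenspace (i : Fin n → ℕ) : Submodule F M :=
  ⨅ k : Fin n, (xOp F M k ^ 2).eigenspace (q F (i k))

theorem mem_sqEigenspace {i : Fin n → ℕ} {v : M} :
    v ∈ sqEigenspace (F := F) M i ↔ ∀ k, xGen F k • xGen F k • v = q F (i k) • v := by
  simp [sqEigenspace, Submodule.mem_iInf, pow_two, xOp]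

theorem x_smul_mem {i : Fin n → ℕ} {v : M} (hv : v ∈ sqEigenspace (F := F) M i) (k : Fin n) :
    xGen F k • v ∈ sqEigenspace (F := F) M i := by
  have : SMulCommClass F (AffineHeckeClifford F n) M := IsScalarTower.to_smulCommClass
  rw [mem_sqEigenspace] at hv ⊢
  intro l
  rw [x_smul_x l k, x_smul_x l k, hv, smul_comm]

theorem c_smul_mem {i : Fin n → ℕ} {v : M} (hv : v ∈ sqEigenspace (F := F) M i) (k : Fin n) :
    cGen F k • v ∈ sqEigenspace (F := F) M i := by
  have : SMulCommClass F (AffineHeckeClifford F n) M := IsScalarTower.to_smulCommClass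
  rw [mem_sqEigenspace] at hv ⊢
  intro l
  rcases eq_or_ne l k with rfl | h
  · rw [x_smul_c_self, smul_neg, x_smul_c_self, neg_neg, hv, smul_comm]
  · rw [x_smul_c h, x_smul_c h, hv, smul_comm]

theorem twist_mem {i : Fin n → ℕ} {v : M} (hv : v ∈ sqEigenspace (F := F) M i) (j l : Fin n) :
    twist F j l v ∈ sqEigenspace (F := F) M i :=
  add_mem (add_mem (x_smul_mem hv _) (x_smul_mem hv _))
    (c_smul_mem (c_smul_mem (sub_mem (x_smul_mem hv _) (x_smul_mem hv _)) _) _)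

/-- The correction terms in `x_sq_smul_s` and `x_succ_sq_smul_s` are ∓`twist`, exactly what the
added `twist` compensates. -/
theorem smul_s_add_twist_mem {i : Fin n → ℕ} {v : M} (hv : v ∈ sqEigenspace (F := F) M i)
    (k : ℕ) (h : k + 1 < n) :
    (q F (i ⟨k, Nat.lt_of_succ_lt h⟩) - q F (i ⟨k + 1, h⟩)) • sGen F k h • v +
      twist F ⟨k, Nat.lt_of_succ_lt h⟩ ⟨k + 1, h⟩ v ∈
        sqEigenspace (F := F) M (i ∘ Equiv.swap ⟨k, Nat.lt_of_succ_lt h⟩ ⟨k + 1, h⟩) := by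
  have : SMulCommClass F (AffineHeckeClifford F n) M := IsScalarTower.to_smulCommClass
  have ht := mem_sqEigenspace.1 (twist_mem hv ⟨k, Nat.lt_of_succ_lt h⟩ ⟨k + 1, h⟩)
  rw [mem_sqEigenspace] at hv ⊢
  intro l
  rw [smul_add, smul_add, ht, smul_comm (xGen F l) (_ : F), smul_comm (xGen F l) (_ : F)]
  by_cases h1 : l = ⟨k, Nat.lt_of_succ_lt h⟩
  · subst h1
    rw [x_sq_smul_s, hv, Function.comp_apply, Equiv.swap_apply_left, smul_comm (sGen F k h) (_ : F)]
    simp only [smul_eq_lsmul]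
    module
  by_cases h2 : l = ⟨k + 1, h⟩
  · subst h2
    rw [x_succ_sq_smul_s, hv, Function.comp_apply, Equiv.swap_apply_right, smul_comm (sGen F k h) (_ : F)]
    simp only [smul_eq_lsmul]
    module
  have h1' : l.val ≠ k := fun e => h1 (Fin.ext e)
  have h2' : l.val ≠ k + 1 := fun e => h2 (Fin.ext e)
  rw [← s_smul_x_of_ne k h h1' h2', ← s_smul_x_of_ne k h h1' h2', hv, Function.comp_apply,
    Equiv.swap_apply_of_ne_of_ne h1 h2, smul_comm (sGen F k h) (_ : F)]
  simp only [smul_eq_lsmul]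
  module

/-- Meant for s_k and s_{k+1} acting as `twist` divided by opposite scalars: the braid relation then
makes the left side vanish. A sum, not a difference, appears because of those opposite signs. -/
theorem twist_braid {i : Fin n → ℕ} {v : M} (hv : v ∈ sqEigenspace (F := F) M i)
    {j k l : Fin n} (hjk : j ≠ k) (hkl : k ≠ l) (hjl : j ≠ l) (hi : i j = i l) :
    twist F j k (twist F k l (twist F j k v)) + twist F k l (twist F j k (twist F k l v)) =
      (6 * q F (i k) + 2 * q F (i j)) • twist F j l v := by
  have : SMulCommClass F (AffineHeckeClifford F n) M := IsScalarTower.to_smulCommClass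
  have hm := fun m => mem_sqEigenspace.1 (x_smul_mem hv m)
  rw [mem_sqEigenspace] at hv
  simp only [twist, smul_add, smul_sub, x_smul_c_self, x_smul_c hjk, x_smul_c hjk.symm,
    x_smul_c hkl, x_smul_c hkl.symm, x_smul_c hjl, x_smul_c hjl.symm, smul_neg,
    c_smul_c_self, c_smul_c hjk.symm, c_smul_c hkl.symm, c_smul_c hjl.symm, neg_neg,
    x_smul_x k j, x_smul_x l j, x_smul_x l k, hm, hv, hi,
    smul_comm (xGen F _) (q F _), smul_comm (cGen F _) (q F _)]
  simp only [smul_eq_lsmul]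
  module

end Twist
-- Consequences of semisimplicity for neighbouring entries.
section Weights

variable {F : Type*} [Field F] {n : ℕ} {M : Type*} [AddCommGroup M] [Module F M]
  [Module (AffineHeckeClifford F n) M] [IsScalarTower F (AffineHeckeClifford F n) M]

theorem x_smul_eq_zero (hcs : IsCompletelySplittable F n M) {k : Fin n} {v : M}
    (hv : xGen F k • xGen F k • v = 0) : xGen F k • v = 0 := by
  have h1 := (hcs k).isFinitelySemisimple.genEigenspace_eq_eigenspace 0 (k := 2) (by simp)
  have h2 : v ∈ (xOp F M k).genEigenspace 0 (2 : ℕ) := by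
    rw [Module.End.mem_genEigenspace_nat]
    simpa [pow_two, xOp] using hv
  have h3 : v ∈ (xOp F M k).eigenspace 0 := h1 ▸ h2
  simpa [xOp, Module.End.mem_eigenspace_iff] using h3

theorem smul_s_eq_of_swap_eq_bot {i : Fin n → ℕ} {k : ℕ} {h : k + 1 < n}
    (hs : sqEigenspace (F := F) M (i ∘ Equiv.swap ⟨k, Nat.lt_of_succ_lt h⟩ ⟨k + 1, h⟩) = ⊥) {z : M}
    (hz : z ∈ sqEigenspace (F := F) M i) :
    (q F (i ⟨k + 1, h⟩) - q F (i ⟨k, Nat.lt_of_succ_lt h⟩)) • sGen F k h • z =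
      twist F ⟨k, Nat.lt_of_succ_lt h⟩ ⟨k + 1, h⟩ z := by
  have := smul_s_add_twist_mem hz k h
  rw [hs, Submodule.mem_bot] at this
  rw [← sub_eq_zero, ← neg_eq_zero, ← this]
  simp only [smul_eq_lsmul]
  module

/-- Otherwise (b - a) s_k = `twist` on the eigenspace; applying this twice compares s_k² = 1 with
`twist_twist`. -/
theorem sqEigenspace_swap_ne_bot {i : Fin n → ℕ} (hi : sqEigenspace (F := F) M i ≠ ⊥)
    (k : ℕ) (h : k + 1 < n)
    (hq : (q F (i ⟨k, Nat.lt_of_succ_lt h⟩) - q F (i ⟨k + 1, h⟩)) ^ 2 ≠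
      2 * (q F (i ⟨k, Nat.lt_of_succ_lt h⟩) + q F (i ⟨k + 1, h⟩))) :
    sqEigenspace (F := F) M (i ∘ Equiv.swap ⟨k, Nat.lt_of_succ_lt h⟩ ⟨k + 1, h⟩) ≠ ⊥ := by
  have : SMulCommClass F (AffineHeckeClifford F n) M := IsScalarTower.to_smulCommClass
  intro hs
  have hne : (⟨k, Nat.lt_of_succ_lt h⟩ : Fin n) ≠ ⟨k + 1, h⟩ := by simp
  obtain ⟨z, hz, hz0⟩ := Submodule.exists_mem_ne_zero_of_ne_bot hi
  have h1 := smul_s_eq_of_swap_eq_bot hs hz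
  have h2 := smul_s_eq_of_swap_eq_bot hs (twist_mem hz ⟨k, Nat.lt_of_succ_lt h⟩ ⟨k + 1, h⟩)
  rw [twist_twist hne, ← h1, smul_comm (sGen F k h), s_smul_s, mem_sqEigenspace.1 hz,
    mem_sqEigenspace.1 hz] at h2
  have h3 : ((q F (i ⟨k, Nat.lt_of_succ_lt h⟩) - q F (i ⟨k + 1, h⟩)) ^ 2 -
      2 * (q F (i ⟨k, Nat.lt_of_succ_lt h⟩) + q F (i ⟨k + 1, h⟩))) • z = 0 := by
    rw [← sub_eq_zero] at h2
    rw [← h2]; module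
  exact hq (sub_eq_zero.1 ((smul_eq_zero.1 h3).resolve_right hz0))

variable [FiniteDimensional F M]

/-- Otherwise v would be a generalized eigenvector of x_k² that is not an eigenvector. -/
theorem x_sq_smul_eq (hcs : IsCompletelySplittable F n M) {k : Fin n} {v w : M} {a : F}
    (hv : xGen F k • xGen F k • v = a • v + w) (hw : xGen F k • xGen F k • w = a • w) :
    w = 0 := by
  have h1 := ((hcs k).pow 2).isFinitelySemisimple.genEigenspace_eq_eigenspace a (k := 2) (by simp)
  have e : ∀ u : M, (xOp F M k ^ 2) u = xGen F k • xGen F k • u := fun u => by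
    simp [pow_two, xOp]
  have h2 : v ∈ (xOp F M k ^ 2).genEigenspace a (2 : ℕ) := by
    rw [Module.End.mem_genEigenspace_nat, LinearMap.mem_ker, pow_two (xOp F M k ^ 2 - _)]
    simp [e, hv, hw, LinearMap.sub_apply]
  have h3 : v ∈ (xOp F M k ^ 2).eigenspace a := h1 ▸ h2
  rw [Module.End.mem_eigenspace_iff, e, hv] at h3
  simpa using h3

theorem weightSpace_eq_sqEigenspace (hcs : IsCompletelySplittable F n M) (i : Fin n → ℕ) :
    weightSpace F M i = sqEigenspace M i :=
  iInf_congr fun k => ((hcs k).pow 2).isFinitelySemisimple.maxGenEigenspace_eq_eigenspace _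

/-- If both eigenvalues equal a, then (x_k² - a) s_k z = -`twist` z, so `twist` z = 0 by
semisimplicity, and `twist_twist` gives 4a = 0. With a = 0 the relation for x_k s_k collapses to z =
c_k c_{k+1} z. -/
theorem q_ne_of_sqEigenspace_ne_bot (hcs : IsCompletelySplittable F n M) (h2 : (2 : F) ≠ 0)
    {i : Fin n → ℕ} (hi : sqEigenspace (F := F) M i ≠ ⊥) (k : ℕ) (h : k + 1 < n) :
    q F (i ⟨k, Nat.lt_of_succ_lt h⟩) ≠ q F (i ⟨k + 1, h⟩) := by
  have : SMulCommClass F (AffineHeckeClifford F n) M := IsScalarTower.to_smulCommClass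
  intro heq
  have hne : (⟨k, Nat.lt_of_succ_lt h⟩ : Fin n) ≠ ⟨k + 1, h⟩ := by simp
  obtain ⟨z, hz, hz0⟩ := Submodule.exists_mem_ne_zero_of_ne_bot hi
  have ht := mem_sqEigenspace.1 (twist_mem hz ⟨k, Nat.lt_of_succ_lt h⟩ ⟨k + 1, h⟩)
  rw [mem_sqEigenspace] at hz
  have hA : -twist F ⟨k, Nat.lt_of_succ_lt h⟩ ⟨k + 1, h⟩ z = 0 := by
    refine x_sq_smul_eq hcs (k := ⟨k, Nat.lt_of_succ_lt h⟩) (v := sGen F k h • z)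
      (a := q F (i ⟨k, Nat.lt_of_succ_lt h⟩)) ?_ ?_
    · rw [x_sq_smul_s, hz, ← heq, smul_comm (sGen F k h), sub_eq_add_neg]
    · simp only [smul_neg, ht]
  rw [neg_eq_zero] at hA
  have hAA := twist_twist (F := F) hne z
  rw [hA, hz, hz, ← heq] at hAA
  have hq : q F (i ⟨k, Nat.lt_of_succ_lt h⟩) = 0 := by
    by_contra hq
    have : (4 * q F (i ⟨k, Nat.lt_of_succ_lt h⟩)) • z = 0 := by
      have h0 : twist F (⟨k, Nat.lt_of_succ_lt h⟩ : Fin n) ⟨k + 1, h⟩ (0 : M) = 0 := by simp [twist]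
      rw [h0] at hAA
      rw [hAA]; module
    rcases smul_eq_zero.1 this with h' | h'
    · rcases mul_eq_zero.1 h' with h' | h'
      · have : (2 : F) * 2 = 0 := by rw [← h']; norm_num
        simp [h2] at this
      · exact hq h'
    · exact hz0 h'
  have hx' : xGen F ⟨k + 1, h⟩ • z = 0 := x_smul_eq_zero hcs (by rw [hz, ← heq, hq, zero_smul])
  have hs : xGen F ⟨k, Nat.lt_of_succ_lt h⟩ • sGen F k h • z = 0 := x_smul_eq_zero hcs (by
    rw [x_sq_smul_s, hz, hA, ← heq, hq]; simp)
  rw [x_smul_s, hx', smul_zero, zero_sub, neg_eq_zero, sub_eq_zero] at hs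
  -- c_k c_{k+1} fixes z but squares to -1, so z = -z.
  have h3 : cGen F ⟨k, Nat.lt_of_succ_lt h⟩ • cGen F ⟨k + 1, h⟩ • z = -z := by
    nth_rewrite 1 [hs]
    rw [c_smul_c hne.symm, smul_neg, c_smul_c_self, c_smul_c_self]
  rw [h3] at hs
  have : (2 : F) • z = 0 := by rw [two_smul]; nth_rewrite 1 [hs]; simp
  exact (smul_ne_zero h2 hz0) this

theorem q_eq_zero_or_of_triple (hcs : IsCompletelySplittable F n M) (h2 : (2 : F) ≠ 0)
    {i : Fin n → ℕ} (hi : sqEigenspace (F := F) M i ≠ ⊥) (k : ℕ) (h : k + 1 + 1 < n)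
    (hik : i ⟨k, Nat.lt_of_succ_lt (Nat.lt_of_succ_lt h)⟩ = i ⟨k + 1 + 1, h⟩) :
    q F (i ⟨k, Nat.lt_of_succ_lt (Nat.lt_of_succ_lt h)⟩) = 0 ∨
      6 * q F (i ⟨k + 1, Nat.lt_of_succ_lt h⟩) + 2 * q F (i ⟨k, Nat.lt_of_succ_lt (Nat.lt_of_succ_lt h)⟩) = 0 := by
  have : SMulCommClass F (AffineHeckeClifford F n) M := IsScalarTower.to_smulCommClass
  have hab : (⟨k, Nat.lt_of_succ_lt (Nat.lt_of_succ_lt h)⟩ : Fin n) ≠ ⟨k + 1, Nat.lt_of_succ_lt h⟩ := by simp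
  have hbc : (⟨k + 1, Nat.lt_of_succ_lt h⟩ : Fin n) ≠ ⟨k + 1 + 1, h⟩ := by simp
  have hac : (⟨k, Nat.lt_of_succ_lt (Nat.lt_of_succ_lt h)⟩ : Fin n) ≠ ⟨k + 1 + 1, h⟩ := by simp; omega
  -- Either swap would place the two equal entries side by side.
  have hs1 : sqEigenspace (F := F) M
      (i ∘ Equiv.swap ⟨k, Nat.lt_of_succ_lt (Nat.lt_of_succ_lt h)⟩ ⟨k + 1, Nat.lt_of_succ_lt h⟩) = ⊥ := by
    by_contra hs
    refine q_ne_of_sqEigenspace_ne_bot hcs h2 hs (k + 1) h ?_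
    simp only [Function.comp_apply, Equiv.swap_apply_right,
      Equiv.swap_apply_of_ne_of_ne hac.symm hbc.symm, hik]
  have hs2 : sqEigenspace (F := F) M
      (i ∘ Equiv.swap ⟨k + 1, Nat.lt_of_succ_lt h⟩ ⟨k + 1 + 1, h⟩) = ⊥ := by
    by_contra hs
    refine q_ne_of_sqEigenspace_ne_bot hcs h2 hs k (by omega) ?_
    simp only [Function.comp_apply, Equiv.swap_apply_left,
      Equiv.swap_apply_of_ne_of_ne hab hac, hik]
  have hd := q_ne_of_sqEigenspace_ne_bot hcs h2 hi k (by omega)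
  obtain ⟨z, hz, hz0⟩ := Submodule.exists_mem_ne_zero_of_ne_bot hi
  set a := q F (i ⟨k, Nat.lt_of_succ_lt (Nat.lt_of_succ_lt h)⟩) with ha
  set b := q F (i ⟨k + 1, Nat.lt_of_succ_lt h⟩) with hb
  have r1 : ∀ {z : M}, z ∈ sqEigenspace (F := F) M i →
      twist F ⟨k, Nat.lt_of_succ_lt (Nat.lt_of_succ_lt h)⟩ ⟨k + 1, Nat.lt_of_succ_lt h⟩ z = (b - a) • sGen F k (Nat.lt_of_succ_lt h) • z :=
    fun hz => (smul_s_eq_of_swap_eq_bot hs1 hz).symm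
  have r2 : ∀ {z : M}, z ∈ sqEigenspace (F := F) M i →
      twist F ⟨k + 1, Nat.lt_of_succ_lt h⟩ ⟨k + 1 + 1, h⟩ z = (a - b) • sGen F (k + 1) h • z := by
    intro z hz
    have := smul_s_eq_of_swap_eq_bot hs2 hz
    rw [← this, ← hik]
  have e1 := r1 (twist_mem (twist_mem hz ⟨k, Nat.lt_of_succ_lt (Nat.lt_of_succ_lt h)⟩ ⟨k + 1, Nat.lt_of_succ_lt h⟩)
    ⟨k + 1, Nat.lt_of_succ_lt h⟩ ⟨k + 1 + 1, h⟩)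
  have e2 := r2 (twist_mem (twist_mem hz ⟨k + 1, Nat.lt_of_succ_lt h⟩ ⟨k + 1 + 1, h⟩)
    ⟨k, Nat.lt_of_succ_lt (Nat.lt_of_succ_lt h)⟩ ⟨k + 1, Nat.lt_of_succ_lt h⟩)
  have hB := twist_braid hz hab hbc hac hik
  rw [e1, e2, r2 (twist_mem hz _ _), r1 (twist_mem hz _ _), r1 hz, r2 hz] at hB
  -- The two braid words agree, with coefficients (b-a)²(a-b) and (a-b)²(b-a), which cancel.
  simp only [smul_comm (sGen F _ _) (_ : F), braid_smul k h] at hB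
  have hB' : (6 * b + 2 * a) • twist F ⟨k, Nat.lt_of_succ_lt (Nat.lt_of_succ_lt h)⟩ ⟨k + 1 + 1, h⟩ z = 0 := by
    rw [← hB]; simp only [smul_eq_lsmul]; module
  rcases smul_eq_zero.1 hB' with h' | h'
  · exact Or.inr h'
  left
  have hT := twist_twist (F := F) hac z
  have h0 : twist F (⟨k, Nat.lt_of_succ_lt (Nat.lt_of_succ_lt h)⟩ : Fin n) ⟨k + 1 + 1, h⟩ (0 : M) = 0 := by simp [twist]
  rw [h', h0, mem_sqEigenspace.1 hz, mem_sqEigenspace.1 hz, ← hik, ← ha] at hT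
  have h3 : (2 * 2 * a) • z = 0 := by rw [hT]; module
  simpa [h2, hz0] using h3

end Weights
-- Arithmetic of q(i) in characteristic p.
section Residues

variable {F : Type*} [Field F] {p : ℕ} [CharP F p]

theorem eq_zero_or_odd_char (F : Type*) [Field F] {p : ℕ} [CharP F p] (hp : p ≠ 2) : p = 0 ∨ 3 ≤ p ∧ 2 * ((p - 1) / 2) + 1 = p := by
  rcases CharP.char_is_prime_or_zero F p with h | h
  · have h2 := h.two_le
    obtain ⟨m, rfl⟩ := h.odd_of_ne_two hp
    omega
  · exact Or.inl h

variable (F) in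
theorem two_ne_zero_of_char_ne_two (hp : p ≠ 2) : (2 : F) ≠ 0 := by
  intro h
  have : ((2 : ℕ) : F) = 0 := by exact_mod_cast h
  rw [CharP.cast_eq_zero_iff F p] at this
  rcases eq_zero_or_odd_char F hp with rfl | h'
  · simp at this
  · have := Nat.le_of_dvd (by norm_num) this
    omega

/-- A positive natural number, at most the characteristic if that is positive, vanishes in `F` only
if it is the characteristic. -/
theorem eq_char_of_cast_eq_zero {N : ℕ} (h : (N : F) = 0) (h0 : 0 < N) (hN : p = 0 ∨ N < 2 * p) :
    N = p := by
  rw [CharP.cast_eq_zero_iff F p] at h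
  obtain ⟨c, rfl⟩ := h
  have hp : p ≠ 0 := by rintro rfl; simp at h0
  have h1 : c < 2 := by
    rcases hN with hN | hN
    · exact absurd hN hp
    · by_contra hc
      have := Nat.mul_le_mul_left p (not_lt.1 hc)
      omega
  have h2 : c ≠ 0 := by rintro rfl; simp at h0
  have : c = 1 := by omega
  simp [this]

theorem q_injOn (hp : p ≠ 2) {i j : ℕ} (hi : i ∈ indexSet p) (hj : j ∈ indexSet p)
    (h : q F i = q F j) : i = j := by
  wlog hij : i < j generalizing i j
  · rcases lt_trichotomy i j with h' | h' | h'
    · exact absurd h' hij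
    · exact h'
    · exact (this hj hi h.symm h').symm
  have hF := eq_zero_or_odd_char F hp
  simp only [indexSet, Set.mem_ofPred_eq] at hi hj
  have h' : (((j - i : ℕ)) : F) * ((i + j + 1 : ℕ) : F) = 0 := by
    rw [Nat.cast_sub hij.le]
    simp only [q] at h
    push_cast
    linear_combination -h
  rcases mul_eq_zero.1 h' with h' | h' <;>
  · have := eq_char_of_cast_eq_zero (p := p) h' (by omega) (by omega)
    omega

theorem q_sub_sq_ne (hp : p ≠ 2) {i j : ℕ} (hi : i ∈ indexSet p) (hj : j ∈ indexSet p)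
    (hne : i ≠ j) (h1 : i ≠ j + 1) (h2 : j ≠ i + 1) :
    (q F i - q F j) ^ 2 ≠ 2 * (q F i + q F j) := by
  wlog hij : i < j generalizing i j
  · have := this hj hi hne.symm h2 h1 (by omega)
    rwa [← neg_sub, neg_sq, add_comm (q F i)]
  intro h
  have hF := eq_zero_or_odd_char F hp
  simp only [indexSet, Set.mem_ofPred_eq] at hi hj
  -- This product is (q(i) - q(j))² - 2(q(i) + q(j)); each factor lies strictly between 0 and p when
  -- p > 0.
  have h' : ((j - i - 1 : ℕ) : F) * ((j - i + 1 : ℕ) : F) *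
      (((i + j : ℕ) : F) * ((i + j + 2 : ℕ) : F)) = 0 := by
    rw [Nat.cast_sub (by omega), Nat.cast_add (j - i), Nat.cast_sub hij.le]
    simp only [q] at h
    push_cast
    linear_combination h
  rcases mul_eq_zero.1 h' with h' | h' <;> rcases mul_eq_zero.1 h' with h' | h' <;>
  · have := eq_char_of_cast_eq_zero (p := p) h' (by omega) (by omega)
    omega

theorem q_ne_zero (hp : p ≠ 2) {i : ℕ} (hi : i ∈ indexSet p) (h0 : 1 ≤ i) : q F i ≠ 0 := by
  intro h
  have : i = 0 := q_injOn hp hi (j := 0) (by simp [indexSet]) (by rw [h]; simp [q])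
  omega

theorem two_mul_add_three_eq (hp : p ≠ 2) {i : ℕ} (hi' : i + 1 ∈ indexSet p)
    (h : 6 * q F (i + 1) + 2 * q F i = 0) : 2 * i + 3 = p := by
  have hF := eq_zero_or_odd_char F hp
  simp only [indexSet, Set.mem_ofPred_eq] at hi'
  have h' : (2 : F) * 2 * (((i + 1 : ℕ) : F) * ((2 * i + 3 : ℕ) : F)) = 0 := by
    simp only [q] at h
    push_cast at h ⊢
    linear_combination h
  have h2 := two_ne_zero_of_char_ne_two F hp
  have := (mul_eq_zero.1 h').resolve_left (mul_ne_zero h2 h2)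
  rcases mul_eq_zero.1 this with h' | h'
  · have := eq_char_of_cast_eq_zero (p := p) h' (by omega) (by omega)
    omega
  · exact eq_char_of_cast_eq_zero (p := p) h' (by omega) (by omega)

theorem six_q_add_two_q_ne_zero (hp : p ≠ 2) {i : ℕ} (hi' : i + 1 ∈ indexSet p) :
    6 * q F i + 2 * q F (i + 1) ≠ 0 := by
  intro h
  have hF := eq_zero_or_odd_char F hp
  simp only [indexSet, Set.mem_ofPred_eq] at hi'
  have h' : (2 : F) * 2 * (((i + 1 : ℕ) : F) * ((2 * i + 1 : ℕ) : F)) = 0 := by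
    simp only [q] at h
    push_cast at h ⊢
    linear_combination h
  have h2 := two_ne_zero_of_char_ne_two F hp
  have := (mul_eq_zero.1 h').resolve_left (mul_ne_zero h2 h2)
  rcases mul_eq_zero.1 this with h' | h' <;>
  · have := eq_char_of_cast_eq_zero (p := p) h' (by omega) (by omega)
    omega

end Residues

/-! ### Combinatorics of admissible words. -/

section Combinatorics

variable {p n : ℕ}

/-- The properties of the set of weights of a completely splittable module from which the
restrictions on the weights follow. -/
structure IsSplittableWeightSet (p : ℕ) (P : (Fin n → ℕ) → Prop) : Prop where
  ne_succ : ∀ i, P i → ∀ k l : Fin n, l.val = k.val + 1 → i k ≠ i l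
  swap : ∀ i, P i → ∀ k l : Fin n, l.val = k.val + 1 → i k ≠ i l + 1 → i l ≠ i k + 1 →
    P (i ∘ Equiv.swap k l)
  triple_pred : ∀ i, P i → ∀ k l m : Fin n, l.val = k.val + 1 → m.val = l.val + 1 →
    i k = i m → i k ≠ i l + 1
  triple_succ : ∀ i, P i → ∀ k l m : Fin n, l.val = k.val + 1 → m.val = l.val + 1 →
    i k = i m → i l = i k + 1 → 1 ≤ i k → 2 * i k + 3 = p

variable {P : (Fin n → ℕ) → Prop}

/-- Swapping `k` with `k + 1` moves the left end of the segment from `k` to `l` to the right. -/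
theorem swap_left_apply (i : Fin n → ℕ) {k k' : Fin n} (hk : k'.val = k.val + 1) :
    (i ∘ Equiv.swap k k') k' = i k ∧ ∀ m, k' < m → (i ∘ Equiv.swap k k') m = i m := by
  refine ⟨by simp, fun m hm => ?_⟩
  rw [Function.comp_apply, Equiv.swap_apply_of_ne_of_ne]
  · rintro rfl; simp only [Fin.lt_def] at hm; omega
  · exact hm.ne'

theorem swap_right_apply (i : Fin n → ℕ) {l l' : Fin n} (hl : l.val = l'.val + 1) :
    (i ∘ Equiv.swap l' l) l' = i l ∧ ∀ m, m < l' → (i ∘ Equiv.swap l' l) m = i m := by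
  refine ⟨by simp, fun m hm => ?_⟩
  rw [Function.comp_apply, Equiv.swap_apply_of_ne_of_ne]
  · exact hm.ne
  · rintro rfl; simp only [Fin.lt_def] at hm; omega

/-- If `i k = i l` for a weight `i`, then either both neighbours inside the segment from `k` to `l`
differ from `i k` by one, or the segment can be shortened by a swap at one of its ends. -/
theorem IsSplittableWeightSet.segment_cases (hP : IsSplittableWeightSet p P) {i : Fin n → ℕ}
    (hi : P i) {k l : Fin n} (hkl : k < l) (h : i k = i l) :
    (∃ (i' : Fin n → ℕ) (k' l' : Fin n), P i' ∧ k ≤ k' ∧ l' ≤ l ∧ k' < l' ∧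
      l'.val + k.val < l.val + k'.val ∧
      i' k' = i k ∧ i' l' = i k ∧ ∀ m, k' < m → m < l' → i' m = i m) ∨
    ∃ k' l' : Fin n, k'.val = k.val + 1 ∧ l.val = l'.val + 1 ∧ k' ≤ l' ∧
      (i k = i k' + 1 ∨ i k' = i k + 1) ∧ (i k = i l' + 1 ∨ i l' = i k + 1) := by
  simp only [Fin.lt_def, Fin.le_def] at *
  have hl := l.isLt
  have hadj : l.val ≠ k.val + 1 := fun e => hP.ne_succ i hi k l e h
  obtain ⟨k', hk'⟩ : ∃ k' : Fin n, k'.val = k.val + 1 := ⟨⟨k.val + 1, by omega⟩, rfl⟩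
  obtain ⟨l', hl'⟩ : ∃ l' : Fin n, l.val = l'.val + 1 :=
    ⟨⟨l.val - 1, by omega⟩, by simp only; omega⟩
  by_cases c1 : i k = i k' + 1 ∨ i k' = i k + 1
  · by_cases c2 : i k = i l' + 1 ∨ i l' = i k + 1
    · exact Or.inr ⟨k', l', hk', hl', by omega, c1, c2⟩
    · push Not at c2
      obtain ⟨e1, e2⟩ := swap_right_apply i hl'
      refine Or.inl ⟨_, k, l', hP.swap i hi l' l hl' (by omega) (by omega), le_rfl, by omega,
        by omega, by omega, e2 k (by rw [Fin.lt_def]; omega), by rw [e1, h],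
        fun m _ hm => e2 m hm⟩
  · push Not at c1
    obtain ⟨e1, e2⟩ := swap_left_apply i hk'
    exact Or.inl ⟨_, k', l, hP.swap i hi k k' hk' (by omega) (by omega), by omega, le_rfl,
      by omega, by omega, e1, by rw [e2 l (by rw [Fin.lt_def]; omega), h], fun m hm _ => e2 m hm⟩

/-- Between two equal entries of a weight lies one that is larger by one. -/
theorem IsSplittableWeightSet.exists_succ (hP : IsSplittableWeightSet p P) {i : Fin n → ℕ}
    (hi : P i) {k l : Fin n} (hkl : k < l) (h : i k = i l) :
    ∃ m, k < m ∧ m < l ∧ i m = i k + 1 := by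
  induction hD : l.val - k.val using Nat.strong_induction_on generalizing i k l with
  | _ D ih =>
  by_cases hno : ∀ m, k < m → m < l → i m ≠ i k
  · by_contra! hc
    rcases hP.segment_cases hi hkl h with
      ⟨i', k', l', hi', h1, h2, h3, h4, h5, h6, h7⟩ | ⟨k', l', h1, h2, h3, h4, h5⟩
    · simp only [Fin.lt_def, Fin.le_def] at *
      obtain ⟨m, hm1, hm2, hm3⟩ := ih (l'.val - k'.val) (by omega) hi' h3 (h5.trans h6.symm) rfl
      exact hc m (by omega) (by omega) (by rw [← h7 m hm1 hm2, hm3, h5])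
    · simp only [Fin.lt_def, Fin.le_def] at *
      -- Both inner neighbours are now i_k - 1. If they are distinct, induction puts an i_k between
      -- them; if they coincide, `triple_pred` applies.
      have e1 := hc k' (by omega) (by omega)
      have e2 := hc l' (by omega) (by omega)
      rcases h3.lt_or_eq with h3 | h3
      · obtain ⟨m, hm1, hm2, hm3⟩ :=
          ih (l'.val - k'.val) (by omega) hi (k := k') (l := l') h3 (by omega) rfl
        exact hno m (by omega) (by omega) (by omega)
      · exact hP.triple_pred i hi k k' l h1 (by omega) h (by omega)
  · push Not at hno
    obtain ⟨m, hm1, hm2, hm3⟩ := hno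
    simp only [Fin.lt_def] at *
    obtain ⟨m', h1, h2, h3⟩ := ih (m.val - k.val) (by omega) hi hm1 hm3.symm rfl
    exact ⟨m', h1, by omega, h3⟩

/-- Shortening ends with both inner neighbours equal to i_k + 1; uniqueness makes them the same
position, and `triple_succ` applies. -/
theorem IsSplittableWeightSet.eq_char_of_unique_succ (hP : IsSplittableWeightSet p P)
    {i : Fin n → ℕ} (hi : P i) {k l : Fin n} (hkl : k < l) (h : i k = i l) (h0 : 1 ≤ i k)
    (hno : ∀ m, k < m → m < l → i m ≠ i k) (hno' : ∀ m, k < m → m < l → i m + 1 ≠ i k)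
    (huniq : ∀ m m', k < m → m < m' → m' < l → i m = i k + 1 → i m' ≠ i k + 1) :
    2 * i k + 3 = p := by
  induction hD : l.val - k.val using Nat.strong_induction_on generalizing i k l with
  | _ D ih =>
  rcases hP.segment_cases hi hkl h with
    ⟨i', k', l', hi', h1, h2, h3, h4, h5, h6, h7⟩ | ⟨k', l', h1, h2, h3, h4, h5⟩
  · simp only [Fin.lt_def, Fin.le_def] at *
    rw [← h5]
    refine ih (l'.val - k'.val) (by omega) hi' h3 (h5.trans h6.symm) (by omega) ?_ ?_ ?_ rfl
    · intro m hm1 hm2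
      rw [h7 m hm1 hm2, h5]
      exact hno m (by omega) (by omega)
    · intro m hm1 hm2
      rw [h7 m hm1 hm2, h5]
      exact hno' m (by omega) (by omega)
    · intro m m' hm1 hm2 hm3
      rw [h7 m hm1 (by omega), h7 m' (by omega) hm3, h5]
      exact huniq m m' (by omega) hm2 (by omega)
  · simp only [Fin.lt_def, Fin.le_def] at *
    have e1 := hno' k' (by omega) (by omega)
    have e2 := hno' l' (by omega) (by omega)
    rcases h3.lt_or_eq with h3 | h3
    · exact absurd (by omega) (huniq k' l' (by omega) h3 (by omega) (by omega))
    · exact hP.triple_succ i hi k k' l h1 (by omega) h (by omega) h0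

/-- Two equal positive entries of a weight without one that is smaller by one between them enclose
a chain of nested pairs around an entry `(p - 1) / 2`. -/
theorem IsSplittableWeightSet.exists_nested_chain (hP : IsSplittableWeightSet p P)
    {i : Fin n → ℕ} (hi : P i) {k l : Fin n} (hkl : k < l) (h : i k = i l) (h0 : 1 ≤ i k)
    (hno : ∀ m, k < m → m < l → i m + 1 ≠ i k) :
    ∃ (d : ℕ) (r t : Fin (d + 1) → Fin n) (q : Fin n),
      2 * (i k + d) + 3 = p ∧ StrictMono r ∧ StrictAnti t ∧
      k ≤ r 0 ∧ r (Fin.last d) < q ∧ q < t (Fin.last d) ∧ t 0 ≤ l ∧ i q = i k + d + 1 ∧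
      ∀ j : Fin (d + 1), i (r j) = i k + j.val ∧ i (t j) = i k + j.val ∧
        ∀ m, r j < m → m < t j → i m ≠ i k + j.val := by
  induction hD : l.val - k.val using Nat.strong_induction_on generalizing k l with
  | _ D ih =>
  by_cases hno2 : ∀ m, k < m → m < l → i m ≠ i k
  · by_cases huniq : ∀ m m', k < m → m < m' → m' < l → i m = i k + 1 → i m' ≠ i k + 1
    · obtain ⟨m, hm1, hm2, hm3⟩ := hP.exists_succ hi hkl h
      refine ⟨0, fun _ => k, fun _ => l, m,
        hP.eq_char_of_unique_succ hi hkl h h0 hno2 hno huniq,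
        fun a b hab => absurd hab (by omega), fun a b hab => absurd hab (by omega), le_rfl, hm1, hm2,
        le_rfl, hm3, fun j => ?_⟩
      obtain rfl : j = 0 := Fin.eq_zero j
      exact ⟨rfl, h.symm, hno2⟩
    · push Not at huniq
      obtain ⟨m, m', hm1, hm2, hm3, hm4, hm5⟩ := huniq
      -- Two entries i_k + 1 with no i_k between them meet the hypotheses again; their chain is
      -- extended outward by the pair (k, l).
      obtain ⟨d, r, t, q, e1, e2, e3, e4, e5, e6, e7, e8, e9⟩ :=
        ih (m'.val - m.val) (by simp only [Fin.lt_def] at *; omega) hm2 (by omega) (by omega)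
          (fun x hx1 hx2 => by
            have := hno2 x (hm1.trans hx1) (hx2.trans hm3)
            omega) rfl
      refine ⟨d + 1, Matrix.vecCons k r, Matrix.vecCons l t, q, by omega,
        strictMono_vecCons.2 ⟨hm1.trans_le e4, e2⟩, strictAnti_vecCons.2 ⟨e7.trans_lt hm3, e3⟩,
        le_rfl, e5, e6, le_rfl, by omega, fun j => ?_⟩
      induction j using Fin.cases with
      | zero => exact ⟨rfl, h.symm, hno2⟩
      | succ j =>
        have hj : i k + j.succ.val = i m + j.val := by rw [Fin.val_succ]; omega
        rw [hj]
        exact e9 j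
  · push Not at hno2
    -- An interior i_k gives a shorter segment whose chain already serves.
    obtain ⟨m, hm1, hm2, hm3⟩ := hno2
    obtain ⟨d, r, t, q, e1, e2, e3, e4, e5, e6, e7, e8⟩ :=
      ih (m.val - k.val) (by simp only [Fin.lt_def] at *; omega) hm1 hm3.symm h0
        (fun x hx1 hx2 => hno x hx1 (hx2.trans hm2)) rfl
    exact ⟨d, r, t, q, e1, e2, e3, e4, e5, e6, e7.trans hm2.le, e8⟩

end Combinatorics

/-! ### Weights of the module, and the theorem. -/

section Weights

variable {F : Type*} [Field F] {p n : ℕ} [CharP F p] {M : Type*} [AddCommGroup M]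
  [Module F M] [Module (AffineHeckeClifford F n) M] [IsScalarTower F (AffineHeckeClifford F n) M]
  [FiniteDimensional F M]

theorem IsCompletelySplittable.isSplittableWeightSet (hcs : IsCompletelySplittable F n M)
    (hp : p ≠ 2) : IsSplittableWeightSet p (IsWeight (n := n) F M p) := by
  have h2 := two_ne_zero_of_char_ne_two F hp
  have key : ∀ i, IsWeight F M p i → ∀ k l m : Fin n, l.val = k.val + 1 → m.val = l.val + 1 →
      i k = i m → q F (i k) = 0 ∨ 6 * q F (i l) + 2 * q F (i k) = 0 := by
    rintro i ⟨-, hi⟩ ⟨k, hk⟩ ⟨l, hl⟩ ⟨m, hm⟩ hkl hlm hkm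
    obtain rfl : l = k + 1 := hkl
    obtain rfl : m = k + 1 + 1 := hlm
    rw [weightSpace_eq_sqEigenspace hcs] at hi
    exact q_eq_zero_or_of_triple hcs h2 hi k hm hkm
  refine ⟨?_, ?_, ?_, ?_⟩
  · rintro i ⟨-, hi⟩ ⟨k, hk⟩ ⟨l, hl⟩ hkl h
    obtain rfl : l = k + 1 := hkl
    rw [weightSpace_eq_sqEigenspace hcs] at hi
    exact q_ne_of_sqEigenspace_ne_bot hcs h2 hi k hl (by rw [h])
  · rintro i ⟨hI, hi⟩ ⟨k, hk⟩ ⟨l, hl⟩ hkl h h'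
    obtain rfl : l = k + 1 := hkl
    refine ⟨fun m => hI _, ?_⟩
    rw [weightSpace_eq_sqEigenspace hcs] at hi ⊢
    by_cases he : i ⟨k, hk⟩ = i ⟨k + 1, hl⟩
    · exact absurd (congrArg (q F) he) (q_ne_of_sqEigenspace_ne_bot hcs h2 hi k hl)
    · exact sqEigenspace_swap_ne_bot hi k hl (q_sub_sq_ne hp (hI _) (hI _) he h h')
  · intro i hi k l m hkl hlm hkm h
    have hI : i l + 1 ∈ indexSet p := h ▸ hi.1 k
    rcases key i hi k l m hkl hlm hkm with h' | h'
    · exact q_ne_zero hp (hi.1 k) (by omega) h'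
    · exact six_q_add_two_q_ne_zero hp hI (h ▸ h')
  · intro i hi k l m hkl hlm hkm h h0
    have hI : i k + 1 ∈ indexSet p := h ▸ hi.1 l
    rcases key i hi k l m hkl hlm hkm with h' | h'
    · exact absurd h' (q_ne_zero hp (hi.1 k) h0)
    · exact two_mul_add_three_eq hp hI (h ▸ h')

end Weights

end HeckeClifford
theorem mainTheorem8 {F : Type*} [Field F] [IsAlgClosed F] (p : ℕ) [CharP F p] (hp : p ≠ 2)
    (n : ℕ) {M : Type*} [AddCommGroup M] [Module F M]
    [Module (HeckeClifford.AffineHeckeClifford F n) M]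
    [IsScalarTower F (HeckeClifford.AffineHeckeClifford F n) M] [FiniteDimensional F M]
    (𝓜 : ZMod 2 → Submodule F M)
    (hirr : HeckeClifford.IsIrreducibleSupermodule (n := n) 𝓜)
    (hint : HeckeClifford.IsIntegralModule F n M p)
    (hcs : HeckeClifford.IsCompletelySplittable F n M)
    (i : Fin n → ℕ) (hi : HeckeClifford.IsWeight F M p i) :
    (∀ k l : Fin n, l.val = k.val + 1 → i k ≠ i l) ∧
    (3 ≤ p → ∀ k l : Fin n, i k = (p - 1) / 2 → i l = (p - 1) / 2 → k = l) ∧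
    (∀ k l : Fin n, k < l → i k = 0 → i l = 0 → ∃ m, k < m ∧ m < l ∧ i m = 1) ∧
    (p = 0 → ∀ k l : Fin n, k < l → i k = i l → 1 ≤ i k →
      (∃ m, k < m ∧ m < l ∧ i m + 1 = i k) ∧ (∃ m, k < m ∧ m < l ∧ i m = i k + 1)) ∧
    (3 ≤ p → ∀ k l : Fin n, k < l → i k = i l → 1 ≤ i k →
      ((∃ m, k < m ∧ m < l ∧ i m + 1 = i k) ∧ (∃ m, k < m ∧ m < l ∧ i m = i k + 1)) ∨
      (∃ (d : ℕ) (r t : Fin (d + 1) → Fin n) (q : Fin n),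
        i k + d = (p - 3) / 2 ∧
        StrictMono r ∧ StrictAnti t ∧
        k ≤ r 0 ∧ r (Fin.last d) < q ∧ q < t (Fin.last d) ∧ t 0 ≤ l ∧
        i q = (p - 1) / 2 ∧
        ∀ j : Fin (d + 1), i (r j) = i k + j.val ∧ i (t j) = i k + j.val ∧
          ∀ m, r j < m → m < t j → i m ≠ i k + j.val)) := by
  have hW := hcs.isSplittableWeightSet hp
  have hodd := HeckeClifford.eq_zero_or_odd_char F hp
  have hI := hi.1
  simp only [HeckeClifford.indexSet, Set.mem_ofPred_eq] at hI
  refine ⟨fun k l hkl => hW.ne_succ i hi k l hkl, ?_, ?_, ?_, ?_⟩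
  · have hlt : 3 ≤ p → ∀ k l : Fin n, k < l → i k = (p - 1) / 2 → i l ≠ (p - 1) / 2 := by
      intro h3 k l hkl hk hl
      -- The entry (p - 1)/2 + 1 produced here lies outside the index set.
      obtain ⟨m, -, -, hm⟩ := hW.exists_succ hi hkl (hk.trans hl.symm)
      have := hI m
      omega
    intro h3 k l hk hl
    rcases lt_trichotomy k l with h | h | h
    · exact absurd hl (hlt h3 k l h hk)
    · exact h
    · exact absurd hk (hlt h3 l k h hl)
  · intro k l hkl hk hl
    obtain ⟨m, h1, h2, h3⟩ := hW.exists_succ hi hkl (hk.trans hl.symm)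
    exact ⟨m, h1, h2, by omega⟩
  · intro h0 k l hkl h h1
    refine ⟨?_, hW.exists_succ hi hkl h⟩
    by_contra! hc
    -- A chain would give 2(i_k + d) + 3 = p = 0.
    obtain ⟨d, -, -, -, hd, -⟩ := hW.exists_nested_chain hi hkl h h1 hc
    omega
  · intro h3 k l hkl h h1
    by_cases hc : ∃ m, k < m ∧ m < l ∧ i m + 1 = i k
    · exact Or.inl ⟨hc, hW.exists_succ hi hkl h⟩
    · push Not at hc
      obtain ⟨d, r, t, q, e1, e2, e3, e4, e5, e6, e7, e8, e9⟩ :=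
        hW.exists_nested_chain hi hkl h h1 hc
      exact Or.inr ⟨d, r, t, q, by omega, e2, e3, e4, e5, e6, e7, by omega, e9⟩
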